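/- **Definitions.** A \emph{Borel–Bratteli diagram} $B=(V,E)$ consists of pairwise disjoint, at most countable vertex sets $V_0,V_1,\dots$ with $V_0=\{v_0\}$ a single point, pairwise disjoint, at most countable edge sets $E_1,E_2,\dots$, and source and range maps $s:E_n\to V_{n-1}$, $r:E_n\to V_n$ ($n\ge1$), such that $s^{-1}(v)\ne\emptyset$ for every $v\in V=\bigcup_{n\ge0}V_n$, and $r^{-1}(v)$ is finite and nonempty for every $v\in V\setminus V_0$. Its path space $Y_B$ is the set of sequences $(e_n)_{n\ge1}$ with $e_n\in E_n$ and $r(e_n)=s(e_{n+1})$ for all $n\ge 1$, with the topology induced from the product of the discrete spaces $E_n$ and the corresponding Borel $\sigma$-algebra. An \emph{ordered Borel–Bratteli diagram} $B=(V,E,\ge)$ is a Borel–Bratteli diagram with a partial order on each $E_n$ in which two edges are comparable if and only if they have the same range (so each $r^{-1}(v)$ is linearly ordered), and such that $Y_B$ contains no path $(e_n)$ for which $e_n$ is the maximal element of $r^{-1}(r(e_n))$ for all sufficiently large $n$, and no path for which $e_n$ is the minimal element of $r^{-1}(r(e_n))$ for all sufficiently large $n$. Its \emph{Vershik transformation}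 $\varphi:Y_B\to Y_B$ sends $y=(e_n)$ to $(f_1,\dots,f_{k-1},f_k,e_{k+1},e_{k+2},\dots)$, where $k$ is the least index such that $e_k$ is not maximal in $r^{-1}(r(e_k))$, $f_k$ is the immediate successor of $e_k$ in $r^{-1}(r(e_k))$, and $(f_1,\dots,f_{k-1})$ is the unique path from $v_0$ to $s(f_k)$ all of whose edges $f_j$ are minimal in $r^{-1}(r(f_j))$. **Theorem.** Let $X$ be a nonempty standard Borel space and let $T:X\to X$ be an aperiodic Borel automorphism, i.e. a Borel bijection with Borel inverse such that $T^n x\ne x$ for all $x\in X$ and $n\ge1$. Then there exists an ordered Borel–Bratteli diagram $B=(V,E,\ge)$ such that the Vershik transformation $\varphi$ is a Borel automorphism of $Y_B$ and $(X,T)$ is isomorphic to $(Y_B,\varphi)$: there is a Borel isomorphism $F:X\to Y_B$ with $F(Tx)=\varphi(F(x))$ for all $x\in X$. -/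

import Mathlib

/-- A Borel–Bratteli diagram. `V n` is the `n`-th set of vertices; `E n` is the set of edges
joining `V n` to `V (n + 1)` (so edges are indexed from `0`). -/
structure BorelBratteliDiagram where
  V : ℕ → Type
  E : ℕ → Type
  root : V 0
  eq_root : ∀ v : V 0, v = root
  countable_V : ∀ n, Countable (V n)
  countable_E : ∀ n, Countable (E n)
  /-- the source map -/
  s : ∀ {n}, E n → V n
  /-- the range map -/
  r : ∀ {n}, E n → V (n + 1)
  exists_s_eq : ∀ {n} (v : V n), ∃ e : E n, s e = v
  exists_r_eq : ∀ {n} (v : V (n + 1)), ∃ e : E n, r e = v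
  finite_r : ∀ {n} (v : V (n + 1)), {e : E n | r e = v}.Finite

/-- The space of infinite paths of a Borel–Bratteli diagram. -/
@[ext]
structure BorelBratteliDiagram.Path (B : BorelBratteliDiagram) where
  edge : ∀ n, B.E n
  r_eq_s : ∀ n, B.r (edge n) = B.s (edge (n + 1))

namespace BorelBratteliDiagram

/-- The topology generated by cylinder sets: the subspace topology of the product of the
discrete spaces `B.E n`. -/
instance (B : BorelBratteliDiagram) : TopologicalSpace B.Path :=
  TopologicalSpace.induced Path.edge (@Pi.topologicalSpace ℕ B.E fun _ => ⊥)

instance (B : BorelBratteliDiagram) : MeasurableSpace B.Path := borel B.Path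

instance (B : BorelBratteliDiagram) : BorelSpace B.Path := ⟨rfl⟩

end BorelBratteliDiagram

/-- An ordered Borel–Bratteli diagram. Two edges of the same level are comparable exactly when
they have the same range, so each finite set `r⁻¹(v)` is linearly ordered, and `IsMax e`
(`IsMin e`) says that `e` is the largest (smallest) element of `r⁻¹(r(e))`. No infinite path has
all but finitely many of its edges maximal, or all but finitely many of its edges minimal. -/
structure OrderedBorelBratteliDiagram extends BorelBratteliDiagram where
  edgeOrder : ∀ n, PartialOrder (E n)
  comparable_iff : ∀ {n} (e f : E n), (e ≤ f ∨ f ≤ e) ↔ r e = r f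
  not_cofinal_max : ¬ ∃ y : toBorelBratteliDiagram.Path, ∃ N, ∀ n ≥ N, IsMax (y.edge n)
  not_cofinal_min : ¬ ∃ y : toBorelBratteliDiagram.Path, ∃ N, ∀ n ≥ N, IsMin (y.edge n)

namespace OrderedBorelBratteliDiagram

instance (B : OrderedBorelBratteliDiagram) (n : ℕ) : PartialOrder (B.E n) := B.edgeOrder n

/-- `z` is obtained from `y` by one step of the Vershik transformation: if `k` is the first level
at which the edge of `y` is not maximal, then the edge of `z` at level `k` is the immediate
successor of that of `y`, the edges of `z` below `k` are minimal, and above `k` the paths agree. -/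
def IsVershikStep (B : OrderedBorelBratteliDiagram) (y z : B.Path) : Prop :=
  ∃ k, (∀ j < k, IsMax (y.edge j)) ∧ ¬ IsMax (y.edge k) ∧ y.edge k ⋖ z.edge k ∧
    (∀ j < k, IsMin (z.edge j)) ∧ ∀ j > k, z.edge j = y.edge j

theorem r_eq_of_le (B : OrderedBorelBratteliDiagram) {n : ℕ} {e f : B.E n} (h : e ≤ f) :
    B.r e = B.r f :=
  (B.comparable_iff e f).1 (Or.inl h)

theorem exists_isMin (B : OrderedBorelBratteliDiagram) {n : ℕ} (v : B.V (n + 1)) :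
    ∃ e : B.E n, B.r e = v ∧ IsMin e := by
  obtain ⟨e, he⟩ := (B.finite_r v).exists_minimal (B.exists_r_eq v)
  exact ⟨e, he.1, fun f hf => he.2 ((B.r_eq_of_le hf).trans he.1) hf⟩

theorem exists_covBy (B : OrderedBorelBratteliDiagram) {n : ℕ} {e : B.E n} (he : ¬ IsMax e) :
    ∃ f : B.E n, e ⋖ f := by
  obtain ⟨f₀, hf₀⟩ := not_isMax_iff.1 he
  have hfin : {f : B.E n | e < f}.Finite :=
    (B.finite_r (B.r e)).subset fun f hf => (B.r_eq_of_le (le_of_lt hf)).symm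
  obtain ⟨f, hf⟩ := hfin.exists_minimal ⟨f₀, hf₀⟩
  exact ⟨f, hf.1, fun g hg hgf => hgf.not_ge (hf.2 hg hgf.le)⟩

theorem exists_path (B : OrderedBorelBratteliDiagram) (k : ℕ) (y : ∀ n, B.E n)
    (hy : ∀ n ≥ k, B.r (y n) = B.s (y (n + 1))) :
    ∃ z : B.Path, (∀ j < k, IsMin (z.edge j)) ∧ ∀ j ≥ k, z.edge j = y j := by
  induction k generalizing y with
  | zero => exact ⟨⟨y, fun n => hy n n.zero_le⟩, by simp, fun _ _ => rfl⟩
  | succ k ih =>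
    obtain ⟨e, her, hem⟩ := B.exists_isMin (B.s (y (k + 1)))
    obtain ⟨z, hz₁, hz₂⟩ := ih (Function.update y k e) (by
      intro n hn
      rcases hn.eq_or_lt with rfl | hn
      · simpa using her
      · rw [Function.update_of_ne (by omega), Function.update_of_ne (by omega)]
        exact hy n hn)
    refine ⟨z, fun j hj => ?_, fun j hj => ?_⟩
    · rcases (Nat.lt_succ_iff.1 hj).eq_or_lt with rfl | hj
      · rw [hz₂ j le_rfl]
        simpa using hem
      · exact hz₁ j hj
    · rw [hz₂ j (by omega), Function.update_of_ne (by omega)]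

theorem existsUnique_isVershikStep (B : OrderedBorelBratteliDiagram) (y : B.Path) :
    ∃! z : B.Path, B.IsVershikStep y z := by
  classical
  have hex : ∃ k, ¬ IsMax (y.edge k) := by
    by_contra! h
    exact B.not_cofinal_max ⟨y, 0, fun n _ => h n⟩
  obtain ⟨k, hk, hmin⟩ : ∃ k, ¬ IsMax (y.edge k) ∧ ∀ j < k, IsMax (y.edge j) :=
    ⟨Nat.find hex, Nat.find_spec hex, fun j hj => not_not.1 (Nat.find_min hex hj)⟩
  obtain ⟨f, hf⟩ := B.exists_covBy hk
  obtain ⟨z, hz₁, hz₂⟩ := B.exists_path k (Function.update y.edge k f) (by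
    intro n hn
    rw [Function.update_of_ne (show n + 1 ≠ k by omega), ← y.r_eq_s n]
    rcases hn.eq_or_lt with rfl | hn
    · simpa using (B.r_eq_of_le hf.le).symm
    · rw [Function.update_of_ne (by omega)])
  have hzk : z.edge k = f := by simpa using hz₂ k le_rfl
  have hzj : ∀ j > k, z.edge j = y.edge j := fun j hj => by
    rw [hz₂ j hj.le, Function.update_of_ne hj.ne']
  refine ⟨z, ⟨k, hmin, hk, hzk ▸ hf, hz₁, hzj⟩, ?_⟩
  rintro w ⟨l, hl₁, hl₂, hl₃, hl₄, hl₅⟩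
  have hlk : l = k :=
    le_antisymm (not_lt.1 fun h => hk (hl₁ _ h)) (not_lt.1 fun h => hl₂ (hmin _ h))
  subst hlk
  have hwl : w.edge l = f := by
    rcases (B.comparable_iff (w.edge l) f).2
      ((B.r_eq_of_le hl₃.le).symm.trans (B.r_eq_of_le hf.le)) with h | h
    · exact h.eq_or_lt.resolve_right fun h => hf.2 hl₃.1 h
    · exact (h.eq_or_lt.resolve_right fun h => hl₃.2 hf.1 h).symm
  have hlow : ∀ i ≤ l, w.edge (l - i) = z.edge (l - i) := by
    intro i
    induction i with
    | zero => intro _; simp [hwl, hzk]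
    | succ i ih =>
      intro hi
      obtain ⟨j, hj⟩ : ∃ j, l - i = j + 1 := ⟨l - i - 1, by omega⟩
      have hj' : l - (i + 1) = j := by omega
      have h := ih (by omega)
      rw [hj] at h
      rw [hj']
      have hr : B.r (w.edge j) = B.r (z.edge j) := by rw [w.r_eq_s, z.r_eq_s, h]
      have hwm := hl₄ j (by omega)
      have hzm := hz₁ j (by omega)
      rcases (B.comparable_iff _ _).2 hr with h | h
      · exact le_antisymm h (hzm h)
      · exact le_antisymm (hwm h) h
  ext n
  rcases le_or_gt n l with h | h
  · have := hlow (l - n) (by omega)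
    rwa [Nat.sub_sub_self h] at this
  · rw [hl₅ n h, hzj n h]

/-- The Vershik transformation of the path space of an ordered Borel–Bratteli diagram. -/
noncomputable def vershik (B : OrderedBorelBratteliDiagram) (y : B.Path) : B.Path :=
  (B.existsUnique_isVershikStep y).choose

theorem vershik_spec (B : OrderedBorelBratteliDiagram) (y : B.Path) :
    B.IsVershikStep y (B.vershik y) :=
  (B.existsUnique_isVershikStep y).choose_spec.1

end OrderedBorelBratteliDiagram

/-! Cut `X` into countable Kakutani–Rokhlin towers over shrinking bases `A 0 = X ⊇ A 1 ⊇ ...`, each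
level refining the previous one. Vertices are towers; an edge is one passage of a tower of level `n
+ 1` through a tower of level `n`, ordered by height. A point gives the path of its towers and
heights, and `T` acts on it as the Vershik step at the last level `k` with `T x ∈ A k`. An
eventually maximal (minimal) path would put the next (last) visit to some `A N` into every `A n`, so
the bases must have empty intersection.

Such bases (`exists_vanishing_markers`) come from a bounded Borel injection into `ℝ`: take the
points whose value is close to its lower limit along the forward or backward orbit, but equal to
neither. Aperiodicity makes the values along an orbit distinct, so every orbit meets these sets in
both directions.

Paths separate points because the towers resolve more and more coordinates of a Borel injection `f`
into the Baire space. Surjectivity is the delicate point, as nested nonempty atoms may have empty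
intersection. Every Borel subset of the Baire space is an injective projection of a closed set
(`hasClosedWitness_of_measurableSet`). Later towers also resolve the witnesses of earlier atoms, so
along a consistent sequence of atoms `f` and all witnesses converge, and the limit lies in every
atom (`exists_towerSystem`). The inverse map is Borel by Lusin–Souslin. -/

section VisitTimes

/-! ### Visit times: base points and heights in columns over `A` -/

variable {X : Type*} [MeasurableSpace X]

/-- The number of steps back from `x` to the most recent visit to `A`. -/
noncomputable def backTime (T : X ≃ᵐ X) (A : Set X) (x : X) : ℕ :=
  sInf {k | T.symm^[k] x ∈ A}

/-- The most recent point of `A` on the backward orbit of `x`. -/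
noncomputable def lastVisit (T : X ≃ᵐ X) (A : Set X) (x : X) : X :=
  T.symm^[backTime T A x] x

/-- The first return time to `A`. -/
noncomputable def returnTime (T : X ≃ᵐ X) (A : Set X) (x : X) : ℕ :=
  sInf {k | 0 < k ∧ T^[k] x ∈ A}

/-- Every orbit visits `A` in the future and in the past. -/
structure IsBirecurrent (T : X ≃ᵐ X) (A : Set X) : Prop where
  exists_forward : ∀ x, ∃ k, 0 < k ∧ T^[k] x ∈ A
  exists_backward : ∀ x, ∃ k, T.symm^[k] x ∈ A

theorem iterate_symm_iterate (T : X ≃ᵐ X) (k : ℕ) (x : X) : T^[k] (T.symm^[k] x) = x :=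
  Function.LeftInverse.iterate T.apply_symm_apply k x

theorem symm_iterate_iterate (T : X ≃ᵐ X) (k : ℕ) (x : X) : T.symm^[k] (T^[k] x) = x :=
  Function.LeftInverse.iterate T.symm_apply_apply k x

theorem symm_iterate_iterate_of_le (T : X ≃ᵐ X) {j k : ℕ} (h : j ≤ k) (x : X) :
    T.symm^[j] (T^[k] x) = T^[k - j] x := by
  obtain ⟨i, rfl⟩ := Nat.exists_eq_add_of_le h
  rw [Function.iterate_add_apply, symm_iterate_iterate, Nat.add_sub_cancel_left]

variable {T : X ≃ᵐ X} {A : Set X}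

theorem IsBirecurrent.lastVisit_mem (hA : IsBirecurrent T A) (x : X) : lastVisit T A x ∈ A :=
  Nat.sInf_mem (hA.exists_backward x)

theorem iterate_lastVisit (T : X ≃ᵐ X) (A : Set X) (x : X) :
    T^[backTime T A x] (lastVisit T A x) = x :=
  iterate_symm_iterate T _ x

theorem IsBirecurrent.returnTime_pos (hA : IsBirecurrent T A) (x : X) : 0 < returnTime T A x :=
  (Nat.sInf_mem (hA.exists_forward x)).1

theorem IsBirecurrent.iterate_returnTime_mem (hA : IsBirecurrent T A) (x : X) :
    T^[returnTime T A x] x ∈ A :=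
  (Nat.sInf_mem (hA.exists_forward x)).2

theorem returnTime_le {x : X} {k : ℕ} (hk : 0 < k) (h : T^[k] x ∈ A) : returnTime T A x ≤ k :=
  Nat.sInf_le ⟨hk, h⟩

theorem backTime_le_of_eq {x y : X} {k : ℕ} (hy : y ∈ A) (h : T^[k] y = x) :
    backTime T A x ≤ k :=
  Nat.sInf_le (by subst h; rwa [Set.mem_ofPred_eq, symm_iterate_iterate])

/-- Otherwise the first return of `lastVisit T A x` would be a more recent visit. With
`backTime_iterate` and `lastVisit_iterate`, this identifies `X` with the region under the graph of
`returnTime` over `A`. -/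
theorem IsBirecurrent.backTime_lt_returnTime (hA : IsBirecurrent T A) (x : X) :
    backTime T A x < returnTime T A (lastVisit T A x) := by
  by_contra! h
  have h1 := backTime_le_of_eq (k := backTime T A x - returnTime T A (lastVisit T A x))
    (hA.iterate_returnTime_mem (lastVisit T A x)) (x := x) (by
      rw [← Function.iterate_add_apply, Nat.sub_add_cancel h, iterate_lastVisit])
  have h2 := hA.returnTime_pos (lastVisit T A x)
  omega

theorem IsBirecurrent.backTime_iterate (hA : IsBirecurrent T A) {y : X} (hy : y ∈ A) {k : ℕ}
    (hk : k < returnTime T A y) : backTime T A (T^[k] y) = k := by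
  have h1 : backTime T A (T^[k] y) ≤ k := backTime_le_of_eq hy rfl
  by_contra h
  have h2 := hA.lastVisit_mem (T^[k] y)
  rw [lastVisit, symm_iterate_iterate_of_le T h1] at h2
  have := returnTime_le (by omega) h2
  omega

theorem IsBirecurrent.lastVisit_iterate (hA : IsBirecurrent T A) {y : X} (hy : y ∈ A) {k : ℕ}
    (hk : k < returnTime T A y) : lastVisit T A (T^[k] y) = y := by
  rw [lastVisit, hA.backTime_iterate hy hk, symm_iterate_iterate]

theorem backTime_of_mem {x : X} (hx : x ∈ A) : backTime T A x = 0 :=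
  Nat.le_zero.1 (backTime_le_of_eq hx rfl)

theorem lastVisit_of_mem {x : X} (hx : x ∈ A) : lastVisit T A x = x := by
  rw [lastVisit, backTime_of_mem hx, Function.iterate_zero_apply]

theorem IsBirecurrent.backTime_le_backTime {A' : Set X} (hA' : IsBirecurrent T A') (h : A' ⊆ A)
    (x : X) : backTime T A x ≤ backTime T A' x :=
  backTime_le_of_eq (h (hA'.lastVisit_mem x)) (iterate_lastVisit T A' x)

theorem IsBirecurrent.iterate_lastVisit_of_subset {A' : Set X} (hA' : IsBirecurrent T A')
    (h : A' ⊆ A) (x : X) :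
    T^[backTime T A' x - backTime T A x] (lastVisit T A' x) = lastVisit T A x := by
  rw [lastVisit, ← symm_iterate_iterate_of_le T (hA'.backTime_le_backTime h x),
    iterate_symm_iterate, lastVisit]

theorem IsBirecurrent.lastVisit_apply (hA : IsBirecurrent T A) {x : X} (hx : T x ∉ A) :
    lastVisit T A (T x) = lastVisit T A x ∧ backTime T A (T x) = backTime T A x + 1 := by
  have h1 : T^[backTime T A x + 1] (lastVisit T A x) = T x := by
    rw [Function.iterate_succ_apply', iterate_lastVisit]
  have h2 : backTime T A x + 1 < returnTime T A (lastVisit T A x) := by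
    refine lt_of_le_of_ne (hA.backTime_lt_returnTime x) fun h => hx ?_
    rw [← h1, h]
    exact hA.iterate_returnTime_mem _
  constructor
  · rw [← hA.lastVisit_iterate (hA.lastVisit_mem x) h2, h1]
  · rw [← hA.backTime_iterate (hA.lastVisit_mem x) h2, h1]

theorem measurable_iterate (T : X ≃ᵐ X) (k : ℕ) : Measurable (T^[k]) := T.measurable.iterate k

theorem IsBirecurrent.measurable_backTime (hA : IsBirecurrent T A) (hm : MeasurableSet A) :
    Measurable (backTime T A) := by
  refine measurable_to_countable' fun k => ?_
  have : backTime T A ⁻¹' {k} = (T.symm^[k] ⁻¹' A) ∩ ⋂ j, ⋂ (_ : j < k), (T.symm^[j] ⁻¹' A)ᶜ := by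
    ext x
    simp only [Set.mem_preimage, Set.mem_singleton_iff, Set.mem_inter_iff, Set.mem_iInter,
      Set.mem_compl_iff]
    constructor
    · rintro rfl
      exact ⟨hA.lastVisit_mem x, fun j hj => Nat.notMem_of_lt_sInf hj⟩
    · rintro ⟨h1, h2⟩
      refine le_antisymm (Nat.sInf_le h1) (not_lt.1 fun h => h2 _ h (hA.lastVisit_mem x))
  rw [this]
  refine (measurable_iterate T.symm k hm).inter
    (MeasurableSet.iInter fun j => MeasurableSet.iInter fun _ => ?_)
  exact (measurable_iterate T.symm j hm).compl

theorem IsBirecurrent.measurable_lastVisit (hA : IsBirecurrent T A) (hm : MeasurableSet A) :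
    Measurable (lastVisit T A) := by
  have h : Measurable fun p : ℕ × X => T.symm^[p.1] p.2 :=
    measurable_from_prod_countable_right fun k => measurable_iterate T.symm k
  exact h.comp ((hA.measurable_backTime hm).prodMk measurable_id)

theorem IsBirecurrent.measurable_returnTime (hA : IsBirecurrent T A) (hm : MeasurableSet A) :
    Measurable (returnTime T A) := by
  refine measurable_to_countable' fun k => ?_
  have : returnTime T A ⁻¹' {k} = {_x | 0 < k} ∩ (T^[k] ⁻¹' A) ∩
      ⋂ j, ⋂ (_ : 0 < j ∧ j < k), (T^[j] ⁻¹' A)ᶜ := by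
    ext x
    simp only [Set.mem_preimage, Set.mem_singleton_iff, Set.mem_inter_iff, Set.mem_iInter,
      Set.mem_compl_iff, Set.mem_ofPred_eq]
    constructor
    · rintro rfl
      exact ⟨⟨hA.returnTime_pos x, hA.iterate_returnTime_mem x⟩,
        fun j hj h => (returnTime_le hj.1 h).not_gt hj.2⟩
    · rintro ⟨h1, h2⟩
      exact le_antisymm (returnTime_le h1.1 h1.2)
        (not_lt.1 fun h => h2 _ ⟨hA.returnTime_pos x, h⟩ (hA.iterate_returnTime_mem x))
  rw [this]
  refine ((MeasurableSet.const _).inter (measurable_iterate T k hm)).inter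
    (MeasurableSet.iInter fun j => MeasurableSet.iInter fun _ => ?_)
  exact (measurable_iterate T j hm).compl

end VisitTimes

/-! ### The Borel structure of the path space -/

namespace BorelBratteliDiagram

theorem measurableSpace_path_eq_comap (B : BorelBratteliDiagram) :
    instMeasurableSpacePath B =
      (@MeasurableSpace.pi ℕ B.E fun _ => ⊤).comap Path.edge := by
  let : ∀ n, TopologicalSpace (B.E n) := fun _ => ⊥
  have : ∀ n, DiscreteTopology (B.E n) := fun _ => ⟨rfl⟩
  have : ∀ n, Countable (B.E n) := B.countable_E
  let : ∀ n, MeasurableSpace (B.E n) := fun _ => ⊤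
  have : ∀ n, BorelSpace (B.E n) := fun _ => ⟨borel_eq_top_of_discrete.symm⟩
  have h : MeasurableSpace.pi = borel (∀ n, B.E n) := BorelSpace.measurable_eq
  rw [h]
  exact borel_comap

theorem countablySeparated_path (B : BorelBratteliDiagram) :
    MeasurableSpace.CountablySeparated B.Path := by
  let : ∀ n, TopologicalSpace (B.E n) := fun _ => ⊥
  have : ∀ n, DiscreteTopology (B.E n) := fun _ => ⟨rfl⟩
  have : ∀ n, Countable (B.E n) := B.countable_E
  have h : Topology.IsEmbedding (Path.edge (B := B)) :=
    ⟨⟨rfl⟩, fun _ _ => Path.ext⟩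
  have := h.secondCountableTopology
  have := h.t2Space
  infer_instance

end BorelBratteliDiagram

/-! ### Tower systems and their ordered diagrams -/

/-- A refining sequence of countable Kakutani–Rokhlin partitions. The bases of the towers of the
`n`-th partition are the fibres of `label n` on `A n`; the atoms of all the partitions separate
points, and every consistent sequence of atoms has a common point. -/
structure TowerSystem {X : Type*} [MeasurableSpace X] (T : X ≃ᵐ X) where
  A : ℕ → Set X
  label : ℕ → X → ℕ
  A_zero : A 0 = Set.univ
  A_succ_subset : ∀ n, A (n + 1) ⊆ A n
  birecurrent : ∀ n, IsBirecurrent T (A n)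
  exists_notMem : ∀ x, ∃ n, x ∉ A n
  measurableSet_A : ∀ n, MeasurableSet (A n)
  measurable_label : ∀ n, Measurable (label n)
  label_zero : ∀ x, label 0 x = 0
  -- The label of a base point determines its return time and its whole itinerary through level `n`.
  -- Level 0 needs no such condition: it is one tower of height 1.
  returnTime_eq : ∀ {n y y'}, y ∈ A (n + 1) → y' ∈ A (n + 1) → label (n + 1) y = label (n + 1) y' →
    returnTime T (A (n + 1)) y = returnTime T (A (n + 1)) y'
  mem_of_mem : ∀ {n y y' i}, y ∈ A (n + 1) → y' ∈ A (n + 1) →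
    label (n + 1) y = label (n + 1) y' → i < returnTime T (A (n + 1)) y →
    T^[i] y ∈ A n → T^[i] y' ∈ A n
  label_eq : ∀ {n y y' i}, y ∈ A (n + 1) → y' ∈ A (n + 1) →
    label (n + 1) y = label (n + 1) y' → i < returnTime T (A (n + 1)) y →
    label n (T^[i] y) = label n (T^[i] y')
  separates : ∀ x x', (∀ n, label n (lastVisit T (A n) x) = label n (lastVisit T (A n) x') ∧
    backTime T (A n) x = backTime T (A n) x') → x = x'
  complete : ∀ v K : ℕ → ℕ, (∀ m, ∃ x, ∀ n ≤ m, label n (lastVisit T (A n) x) = v n ∧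
    backTime T (A n) x = K n) →
    ∃ x, ∀ n, label n (lastVisit T (A n) x) = v n ∧ backTime T (A n) x = K n

namespace TowerSystem

variable {X : Type*} [MeasurableSpace X] {T : X ≃ᵐ X} (S : TowerSystem T)

theorem A_antitone : Antitone S.A := antitone_nat_of_succ_le S.A_succ_subset

/-- The label of the tower of level `n` containing `x`. -/
noncomputable def tower (n : ℕ) (x : X) : ℕ := S.label n (lastVisit T (S.A n) x)

/-- The height of `x` in the tower of level `n` containing it. -/
noncomputable def height (n : ℕ) (x : X) : ℕ := backTime T (S.A n) x

/-- The vertices of level `n`: labels of the towers of level `n`. -/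
def Vertex (n : ℕ) : Type := {v : ℕ // ∃ y ∈ S.A n, S.label n y = v}

/-- The edges from level `n` to level `n + 1`. The triple `(v, i, u)` stands for the tower `u` of
level `n` being traversed by the tower `v` of level `n + 1` from the height `i` on. -/
def Edge (n : ℕ) : Type := {t : ℕ × ℕ × ℕ // ∃ y ∈ S.A (n + 1), S.label (n + 1) y = t.1 ∧
  t.2.1 < returnTime T (S.A (n + 1)) y ∧ T^[t.2.1] y ∈ S.A n ∧ S.label n (T^[t.2.1] y) = t.2.2}

variable {S}

/-- The label fixes the itinerary, so every base point of the tower witnesses the edge, not only the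
one supplied. -/
theorem Edge.spec {n : ℕ} (e : S.Edge n) {y : X} (hy : y ∈ S.A (n + 1))
    (hl : S.label (n + 1) y = e.1.1) :
    e.1.2.1 < returnTime T (S.A (n + 1)) y ∧ T^[e.1.2.1] y ∈ S.A n ∧
      S.label n (T^[e.1.2.1] y) = e.1.2.2 := by
  obtain ⟨y', hy', hl', hi, hm, hu⟩ := e.2
  have h := hl'.trans hl.symm
  exact ⟨S.returnTime_eq hy' hy h ▸ hi, S.mem_of_mem hy' hy h hi hm,
    (S.label_eq hy' hy h hi).symm.trans hu⟩

/-- The lower label is redundant: it is read off at the given height of the upper tower. -/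
theorem Edge.ext_of_eq {n : ℕ} {e f : S.Edge n} (hv : e.1.1 = f.1.1) (hi : e.1.2.1 = f.1.2.1) :
    e = f := by
  obtain ⟨y, hy, hl, -, -, hu⟩ := e.2
  have h := (f.spec hy (hl.trans hv)).2.2
  exact Subtype.ext (Prod.ext hv (Prod.ext hi (by rw [← hu, ← h, hi])))

variable (S)

theorem tower_zero (x : X) : S.tower 0 x = 0 := S.label_zero _

theorem height_zero (x : X) : S.height 0 x = 0 := backTime_of_mem (by simp [S.A_zero])

theorem height_le_succ (n : ℕ) (x : X) : S.height n x ≤ S.height (n + 1) x :=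
  (S.birecurrent (n + 1)).backTime_le_backTime (S.A_succ_subset n) x

theorem measurable_tower (n : ℕ) : Measurable (S.tower n) :=
  (S.measurable_label n).comp ((S.birecurrent n).measurable_lastVisit (S.measurableSet_A n))

theorem measurable_height (n : ℕ) : Measurable (S.height n) :=
  (S.birecurrent n).measurable_backTime (S.measurableSet_A n)

/-- The edge of level `n` of the path of `x`. -/
noncomputable def edgeOf (n : ℕ) (x : X) : S.Edge n :=
  -- The difference of heights is where the current passage through level `n` began.
  ⟨(S.tower (n + 1) x, S.height (n + 1) x - S.height n x, S.tower n x), by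
    have h := (S.birecurrent (n + 1)).iterate_lastVisit_of_subset (S.A_succ_subset n) x
    refine ⟨lastVisit T (S.A (n + 1)) x, (S.birecurrent _).lastVisit_mem x, rfl, ?_, ?_, ?_⟩
    · exact (Nat.sub_le _ _).trans_lt ((S.birecurrent (n + 1)).backTime_lt_returnTime x)
    · dsimp only [height]
      rw [h]
      exact (S.birecurrent n).lastVisit_mem x
    · dsimp only [height]
      rw [h]
      rfl⟩

/-- The Borel–Bratteli diagram of a system of towers. -/
@[reducible]
def diagram [Nonempty X] : BorelBratteliDiagram where
  V := S.Vertex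
  E := S.Edge
  root := ⟨0, Classical.arbitrary X, by simp [S.A_zero], S.label_zero _⟩
  eq_root := by
    rintro ⟨v, y, -, rfl⟩
    exact Subtype.ext (S.label_zero y)
  countable_V _ := Subtype.countable
  countable_E _ := Subtype.countable
  s e := ⟨e.1.2.2, by
    obtain ⟨y, -, -, -, h⟩ := e.2
    exact ⟨_, h⟩⟩
  r e := ⟨e.1.1, by
    obtain ⟨y, hy, h, -⟩ := e.2
    exact ⟨y, hy, h⟩⟩
  exists_s_eq := by
    rintro n ⟨v, y, hy, rfl⟩
    exact ⟨S.edgeOf n y, Subtype.ext (congrArg (S.label n) (lastVisit_of_mem hy))⟩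
  exists_r_eq := by
    rintro n ⟨v, y, hy, rfl⟩
    exact ⟨⟨(S.label (n + 1) y, 0, S.label n y), y, hy, rfl, (S.birecurrent _).returnTime_pos y,
      S.A_succ_subset n hy, rfl⟩, rfl⟩
  finite_r := by
    rintro n ⟨v, y, hy, rfl⟩
    refine Set.Finite.of_finite_image (f := fun e : S.Edge n => e.1.2.1)
      ((Set.finite_Iio (returnTime T (S.A (n + 1)) y)).subset ?_) ?_
    · rintro _ ⟨e, he, rfl⟩
      exact (e.spec hy (congrArg Subtype.val he).symm).1
    · intro e he f hf h
      exact Edge.ext_of_eq ((congrArg Subtype.val he).trans (congrArg Subtype.val hf).symm) h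

/-- Edges with the same range are ordered by height. -/
@[reducible]
def edgeOrder (n : ℕ) : PartialOrder (S.Edge n) where
  le e f := e.1.1 = f.1.1 ∧ e.1.2.1 ≤ f.1.2.1
  le_refl _ := ⟨rfl, le_rfl⟩
  le_trans _ _ _ h h' := ⟨h.1.trans h'.1, h.2.trans h'.2⟩
  le_antisymm _ _ h h' := Edge.ext_of_eq h.1 (le_antisymm h.2 h'.2)

/-- The next larger edge would start at the next visit to `A n`, and the column ends at the next
visit to `A (n + 1)`. So maximality means that the former never comes strictly before the latter. -/
theorem isMax_edgeOf_iff {n : ℕ} {x : X} : @IsMax _ (S.edgeOrder n).toLE (S.edgeOf n x) ↔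
    ∀ m, 0 < m → T^[m] x ∈ S.A n → ∃ j, 0 < j ∧ j ≤ m ∧ T^[j] x ∈ S.A (n + 1) := by
  let := S.edgeOrder n
  set y := lastVisit T (S.A (n + 1)) x with hy
  have hyA : y ∈ S.A (n + 1) := (S.birecurrent _).lastVisit_mem x
  have hxy : ∀ m, T^[m] x = T^[m + S.height (n + 1) x] y := fun m => by
    rw [Function.iterate_add_apply, hy, height, iterate_lastVisit]
  have hlt : S.height (n + 1) x < returnTime T (S.A (n + 1)) y :=
    (S.birecurrent _).backTime_lt_returnTime x
  constructor
  · intro h m hm hmA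
    by_contra! hc
    have hr : m + S.height (n + 1) x < returnTime T (S.A (n + 1)) y := by
      by_contra! hr
      refine hc (returnTime T (S.A (n + 1)) y - S.height (n + 1) x) (by omega) (by omega) ?_
      rw [hxy, Nat.sub_add_cancel hlt.le]
      exact (S.birecurrent _).iterate_returnTime_mem y
    rw [hxy] at hmA
    let f : S.Edge n := ⟨(S.tower (n + 1) x, m + S.height (n + 1) x,
      S.label n (T^[m + S.height (n + 1) x] y)), y, hyA, rfl, hr, hmA, rfl⟩
    have h1 : S.edgeOf n x ≤ f := ⟨rfl, by
      change S.height (n + 1) x - S.height n x ≤ m + S.height (n + 1) x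
      omega⟩
    have h2 : m + S.height (n + 1) x ≤ S.height (n + 1) x - S.height n x := (h h1).2
    omega
  · rintro h f ⟨hv, hi⟩
    obtain ⟨h1, h2, -⟩ := f.spec hyA hv
    refine ⟨hv.symm, ?_⟩
    change f.1.2.1 ≤ S.height (n + 1) x - S.height n x
    by_contra! hc
    have hle := S.height_le_succ n x
    -- A larger edge starts either at or below `x`, giving a visit to `A n` more recent than the
    -- last one, or above `x`, giving a future visit within the same column.
    by_cases hh : f.1.2.1 ≤ S.height (n + 1) x
    · have h3 : S.height n x ≤ S.height (n + 1) x - f.1.2.1 :=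
        backTime_le_of_eq h2 (by
          rw [← Function.iterate_add_apply, Nat.sub_add_cancel hh, hy, height, iterate_lastVisit])
      omega
    · obtain ⟨j, hj0, hj, hjA⟩ := h (f.1.2.1 - S.height (n + 1) x) (by omega) (by
        rwa [hxy, Nat.sub_add_cancel (by omega)])
      rw [hxy] at hjA
      have := returnTime_le (by omega) hjA
      omega

/-- The smallest edge starts at height 0, so minimality means that the last visits to `A n` and `A
(n + 1)` coincide. -/
theorem isMin_edgeOf_iff {n : ℕ} {x : X} : @IsMin _ (S.edgeOrder n).toLE (S.edgeOf n x) ↔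
    S.height (n + 1) x = S.height n x := by
  let := S.edgeOrder n
  have hle := S.height_le_succ n x
  constructor
  · intro h
    have hyA := (S.birecurrent (n + 1)).lastVisit_mem x
    let f : S.Edge n := ⟨(S.tower (n + 1) x, 0, S.label n (lastVisit T (S.A (n + 1)) x)),
      _, hyA, rfl, (S.birecurrent _).returnTime_pos _, S.A_succ_subset n hyA, rfl⟩
    have h1 : f ≤ S.edgeOf n x := ⟨rfl, Nat.zero_le _⟩
    have h2 : S.height (n + 1) x - S.height n x ≤ 0 := (h h1).2
    omega
  · rintro h f ⟨hv, hi⟩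
    refine ⟨hv.symm, ?_⟩
    change S.height (n + 1) x - S.height n x ≤ _
    omega

variable [Nonempty X]

/-- The path of a point. -/
noncomputable def pathOf (x : X) : S.diagram.Path where
  edge n := S.edgeOf n x
  r_eq_s _ := rfl

theorem pathOf_injective : Function.Injective S.pathOf := by
  intro x x' h
  have he : ∀ n, S.edgeOf n x = S.edgeOf n x' := fun n => congrArg (fun p => p.edge n) h
  refine S.separates x x' fun n => ?_
  change S.tower n x = S.tower n x' ∧ S.height n x = S.height n x'
  induction n with
  | zero => simp [tower_zero, height_zero]
  | succ n ih =>
    have h1 := congrArg Subtype.val (he n)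
    simp only [edgeOf, Prod.mk.injEq] at h1
    have := S.height_le_succ n x
    have := S.height_le_succ n x'
    exact ⟨h1.1, by omega⟩

/-- Here `v` and `K` are the towers and heights prescribed by `p`. Climbing `K n` floors from any
base point of the tower `v n` realizes the first `n` edges. -/
theorem exists_finite_path (p : S.diagram.Path) (v K : ℕ → ℕ) (hv : v 0 = 0) (hK : K 0 = 0)
    (hvs : ∀ n, v (n + 1) = (p.edge n).1.1) (hKs : ∀ n, K (n + 1) = (p.edge n).1.2.1 + K n)
    (n : ℕ) (y : X) (hy : y ∈ S.A n) (hl : S.label n y = v n) :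
    K n < returnTime T (S.A n) y ∧
      ∀ m ≤ n, S.tower m (T^[K n] y) = v m ∧ S.height m (T^[K n] y) = K m := by
  have key : ∀ n, v n = (p.edge n).1.2.2 := by
    rintro (_ | n)
    · obtain ⟨y, -, -, -, -, h⟩ := (p.edge 0).2
      rw [hv, ← h, S.label_zero]
    · exact (hvs n).trans (congrArg Subtype.val (p.r_eq_s n))
  induction n generalizing y with
  | zero =>
    rw [hK]
    refine ⟨(S.birecurrent 0).returnTime_pos y, fun m hm => ?_⟩
    obtain rfl := Nat.le_zero.1 hm
    rw [S.tower_zero, S.height_zero, hv, hK]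
    exact ⟨rfl, rfl⟩
  | succ n ih =>
    obtain ⟨h1, h2, h3⟩ := (p.edge n).spec hy (hl.trans (hvs n))
    obtain ⟨ih1, ih2⟩ := ih _ h2 (h3.trans (key n).symm)
    have hx : T^[K (n + 1)] y = T^[K n] (T^[(p.edge n).1.2.1] y) := by
      rw [← Function.iterate_add_apply, hKs, add_comm]
    have hlt : K (n + 1) < returnTime T (S.A (n + 1)) y := by
      -- The end of the column over `A (n + 1)` is also a visit to `A n`, so it cannot interrupt the
      -- last passage through level `n`.
      by_contra! h
      have h4 := S.A_succ_subset n ((S.birecurrent (n + 1)).iterate_returnTime_mem y)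
      rw [← Nat.sub_add_cancel h1.le, Function.iterate_add_apply] at h4
      have := returnTime_le (by omega) h4
      rw [hKs] at h
      omega
    refine ⟨hlt, fun m hm => ?_⟩
    rcases hm.eq_or_lt with rfl | hm
    · exact ⟨by rw [tower, (S.birecurrent _).lastVisit_iterate hy hlt, hl],
        (S.birecurrent _).backTime_iterate hy hlt⟩
    · rw [hx]
      exact ih2 m (Nat.lt_succ_iff.1 hm)

theorem pathOf_surjective : Function.Surjective S.pathOf := by
  intro p
  let v : ℕ → ℕ := fun n => Nat.casesOn n 0 fun n => (p.edge n).1.1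
  let K : ℕ → ℕ := fun n => ∑ m ∈ Finset.range n, (p.edge m).1.2.1
  have hv : v 0 = 0 := rfl
  have hvs : ∀ n, v (n + 1) = (p.edge n).1.1 := fun n => rfl
  have hK : K 0 = 0 := rfl
  have hKs : ∀ n, K (n + 1) = (p.edge n).1.2.1 + K n := fun n =>
    (Finset.sum_range_succ _ _).trans (add_comm _ _)
  obtain ⟨x, hx⟩ := S.complete v K fun m => by
    obtain ⟨y, hy, hl⟩ : ∃ y ∈ S.A m, S.label m y = v m := by
      cases m with
      | zero => exact ⟨Classical.arbitrary X, by simp [S.A_zero], S.label_zero _⟩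
      | succ m =>
        obtain ⟨y, hy, hl, -⟩ := (p.edge m).2
        exact ⟨y, hy, hl⟩
    exact ⟨T^[K m] y, (S.exists_finite_path p v K hv hK hvs hKs m y hy hl).2⟩
  refine ⟨x, BorelBratteliDiagram.Path.ext (funext fun n => Edge.ext_of_eq ?_ ?_)⟩
  · exact (hx (n + 1)).1
  · have h1 : S.height (n + 1) x = K (n + 1) := (hx (n + 1)).2
    have h2 : S.height n x = K n := (hx n).2
    change S.height (n + 1) x - S.height n x = _
    rw [h1, h2, hKs, Nat.add_sub_cancel_right]

/-- The ordered Borel–Bratteli diagram of a system of towers. -/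
@[reducible]
def orderedDiagram : OrderedBorelBratteliDiagram where
  toBorelBratteliDiagram := S.diagram
  edgeOrder := S.edgeOrder
  comparable_iff e f := by
    constructor
    · rintro (h | h)
      · exact Subtype.ext h.1
      · exact Subtype.ext h.1.symm
    · intro h
      have h := congrArg Subtype.val h
      exact (le_total e.1.2.1 f.1.2.1).imp (fun h' => ⟨h, h'⟩) (fun h' => ⟨h.symm, h'⟩)
  not_cofinal_max := by
    rintro ⟨p, N, hN⟩
    obtain ⟨x, rfl⟩ := S.pathOf_surjective p
    -- Maximality makes the next visits to `A n` and `A (n + 1)` coincide, so the next visit to `A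
    -- N` lies in all bases.
    have hmem : ∀ n ≥ N, returnTime T (S.A n) x = returnTime T (S.A N) x := by
      intro n hn
      induction n, hn using Nat.le_induction with
      | base => rfl
      | succ n hn ih =>
        rw [← ih]
        obtain ⟨j, hj, hjm, hjA⟩ := S.isMax_edgeOf_iff.1 (hN n hn) _
          ((S.birecurrent n).returnTime_pos x) ((S.birecurrent n).iterate_returnTime_mem x)
        refine le_antisymm ((returnTime_le hj hjA).trans hjm) ?_
        exact returnTime_le ((S.birecurrent _).returnTime_pos x)
          (S.A_succ_subset n ((S.birecurrent _).iterate_returnTime_mem x))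
    obtain ⟨n, hn⟩ := S.exists_notMem (T^[returnTime T (S.A N) x] x)
    refine hn (S.A_antitone (le_max_left n N) ?_)
    rw [← hmem (max n N) (le_max_right n N)]
    exact (S.birecurrent _).iterate_returnTime_mem x
  not_cofinal_min := by
    rintro ⟨p, N, hN⟩
    obtain ⟨x, rfl⟩ := S.pathOf_surjective p
    have hmem : ∀ n ≥ N, S.height n x = S.height N x := by
      intro n hn
      induction n, hn using Nat.le_induction with
      | base => rfl
      | succ n hn ih => rw [← ih, S.isMin_edgeOf_iff.1 (hN n hn)]
    obtain ⟨n, hn⟩ := S.exists_notMem (T.symm^[S.height N x] x)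
    refine hn (S.A_antitone (le_max_left n N) ?_)
    rw [← hmem (max n N) (le_max_right n N)]
    exact (S.birecurrent _).lastVisit_mem x

theorem isVershikStep_pathOf (x : X) :
    S.orderedDiagram.IsVershikStep (S.pathOf x) (S.pathOf (T x)) := by
  classical
  obtain ⟨k, hk, hk'⟩ : ∃ k, T x ∉ S.A (k + 1) ∧ T x ∈ S.A k := by
    have hex := S.exists_notMem (T x)
    have hpos : Nat.find hex ≠ 0 := fun h => by
      have := Nat.find_spec hex
      rw [h, S.A_zero] at this
      exact this (Set.mem_univ _)
    obtain ⟨k, hk⟩ := Nat.exists_eq_succ_of_ne_zero hpos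
    exact ⟨k, by simpa only [hk] using Nat.find_spec hex, not_not.1 (Nat.find_min hex (by omega))⟩
  have hlow : ∀ j ≤ k, T x ∈ S.A j := fun j hj => S.A_antitone hj hk'
  -- Above level `k` no new column begins: the towers stay and all heights grow by 1, so their
  -- differences are unchanged.
  have hhigh : ∀ j > k, lastVisit T (S.A j) (T x) = lastVisit T (S.A j) x ∧
      S.height j (T x) = S.height j x + 1 := fun j hj =>
    (S.birecurrent j).lastVisit_apply fun h => hk (S.A_antitone hj h)
  obtain ⟨hv, hh⟩ := hhigh (k + 1) (Nat.lt_succ_self k)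
  have h0 : S.height k (T x) = 0 := backTime_of_mem hk'
  have hle := S.height_le_succ k x
  let := S.edgeOrder k
  have hlt : S.edgeOf k x < S.edgeOf k (T x) := by
    refine lt_of_le_not_ge ⟨(congrArg (S.label (k + 1)) hv).symm, ?_⟩ fun h => ?_
    · change _ - _ ≤ _ - _
      omega
    · have : S.height (k + 1) (T x) - S.height k (T x) ≤ S.height (k + 1) x - S.height k x := h.2
      omega
  refine ⟨k, fun j hj => ?_, hlt.not_isMax, ⟨hlt, ?_⟩, fun j hj => ?_, fun j hj => ?_⟩
  · exact S.isMax_edgeOf_iff.2 fun m hm _ => ⟨1, one_pos, hm, hlow (j + 1) hj⟩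
  -- An edge strictly in between would start at a visit to `A k` after the last one and no later
  -- than `x`.
  · rintro f ⟨⟨hf1, hf2⟩, hf3⟩ ⟨⟨hf4, hf5⟩, hf6⟩
    have hf7 : ¬ f.1.2.1 ≤ S.height (k + 1) x - S.height k x := fun h => hf3 ⟨hf1.symm, h⟩
    have hf8 : ¬ S.height (k + 1) (T x) - S.height k (T x) ≤ f.1.2.1 := fun h => hf6 ⟨hf4.symm, h⟩
    obtain ⟨-, h2, -⟩ := f.spec ((S.birecurrent (k + 1)).lastVisit_mem x) hf1
    have h3 : S.height k x ≤ S.height (k + 1) x - f.1.2.1 := backTime_le_of_eq h2 (by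
      rw [← Function.iterate_add_apply, Nat.sub_add_cancel (by omega), height, iterate_lastVisit])
    omega
  · refine S.isMin_edgeOf_iff.2 ?_
    rw [height, height, backTime_of_mem (hlow _ hj), backTime_of_mem (hlow _ hj.le)]
  · obtain ⟨h1, h2⟩ := hhigh j hj
    obtain ⟨h3, h4⟩ := hhigh (j + 1) (by omega)
    refine Edge.ext_of_eq (congrArg (S.label (j + 1)) h3) ?_
    change S.height (j + 1) (T x) - S.height j (T x) = S.height (j + 1) x - S.height j x
    omega

theorem measurable_pathOf : Measurable S.pathOf := by
  let : ∀ n, MeasurableSpace (S.Edge n) := fun _ => ⊤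
  have : ∀ n, Countable (S.Edge n) := S.diagram.countable_E
  rw [measurable_iff_comap_le, BorelBratteliDiagram.measurableSpace_path_eq_comap,
    MeasurableSpace.comap_comp, ← measurable_iff_comap_le]
  refine measurable_pi_lambda _ fun n => measurable_to_countable' fun e => ?_
  have h : Measurable fun x => (S.tower (n + 1) x, S.height (n + 1) x - S.height n x, S.tower n x) :=
    (S.measurable_tower _).prodMk
      (((S.measurable_height _).sub (S.measurable_height _)).prodMk (S.measurable_tower _))
  convert h (measurableSet_singleton e.1) using 1
  ext x
  exact Subtype.ext_iff

/-- A Borel automorphism with a system of towers is isomorphic to a Vershik transformation. -/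
theorem exists_vershik_isomorphism [StandardBorelSpace X] (S : TowerSystem T) :
    ∃ (B : OrderedBorelBratteliDiagram) (φ : B.Path ≃ᵐ B.Path),
      (∀ y, φ y = B.vershik y) ∧ ∃ F : X ≃ᵐ B.Path, ∀ x, F (T x) = φ (F x) := by
  have := S.diagram.countablySeparated_path
  let F : X ≃ᵐ S.diagram.Path :=
    { toEquiv := Equiv.ofBijective S.pathOf ⟨S.pathOf_injective, S.pathOf_surjective⟩
      measurable_toFun := S.measurable_pathOf
      measurable_invFun := fun s hs => by
        rw [← Equiv.image_eq_preimage_symm]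
        -- Lusin–Souslin: an injective Borel map from a standard Borel space to a countably
        -- separated one has Borel images.
        exact (S.measurable_pathOf.measurableEmbedding
          S.pathOf_injective).measurableSet_image.2 hs }
  have hF : ∀ x, F x = S.pathOf x := fun x => rfl
  refine ⟨S.orderedDiagram, F.symm.trans (T.trans F), fun y => ?_, F, fun x => ?_⟩
  · refine (S.orderedDiagram.existsUnique_isVershikStep y).unique ?_
      (S.orderedDiagram.vershik_spec y)
    have h := S.isVershikStep_pathOf (F.symm y)
    rwa [← hF, ← hF, F.apply_symm_apply] at h
  · simp

end TowerSystem

/-! ### Vanishing markers -/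

open Filter in
theorem frequently_abs_sub_liminf_lt {u : ℕ → ℝ} {C : ℝ} (hu : ∀ k, |u k| ≤ C) {ε : ℝ}
    (hε : 0 < ε) : ∃ᶠ k in atTop, |u k - liminf u atTop| < ε := by
  have hb : IsBoundedUnder (· ≥ ·) atTop u :=
    isBoundedUnder_of ⟨-C, fun k => (abs_le.1 (hu k)).1⟩
  have hc : IsCoboundedUnder (· ≥ ·) atTop u :=
    IsBoundedUnder.isCoboundedUnder_ge (isBoundedUnder_of ⟨C, fun k => (abs_le.1 (hu k)).2⟩)
  have h1 : ∃ᶠ k in atTop, u k < liminf u atTop + ε :=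
    frequently_lt_of_liminf_lt hc (by linarith)
  have h2 : ∀ᶠ k in atTop, liminf u atTop - ε < u k :=
    eventually_lt_of_lt_liminf (by linarith) hb
  refine (h1.and_eventually h2).mono fun k hk => abs_lt.2 ⟨?_, ?_⟩ <;> linarith [hk.1, hk.2]

section Markers

variable {X : Type*} [MeasurableSpace X]

open Filter

/-- The lower limit of `f` along the forward orbit of `x`. -/
noncomputable def orbitLiminf (T : X ≃ᵐ X) (f : X → ℝ) (x : X) : ℝ :=
  liminf (fun k => f (T^[k] x)) atTop

theorem measurable_orbitLiminf (T : X ≃ᵐ X) {f : X → ℝ} (hf : Measurable f) :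
    Measurable (orbitLiminf T f) :=
  Measurable.liminf fun k => hf.comp (measurable_iterate T k)

theorem orbitLiminf_apply (T : X ≃ᵐ X) (f : X → ℝ) (x : X) :
    orbitLiminf T f (T x) = orbitLiminf T f x := by
  simp only [orbitLiminf, ← Function.iterate_succ_apply]
  exact liminf_nat_add (fun k => f (T^[k] x)) 1

theorem orbitLiminf_symm_apply (T : X ≃ᵐ X) (f : X → ℝ) (x : X) :
    orbitLiminf T f (T.symm x) = orbitLiminf T f x := by
  rw [← orbitLiminf_apply, T.apply_symm_apply]

theorem orbitLiminf_iterate (T : X ≃ᵐ X) (f : X → ℝ) (x : X) (k : ℕ) :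
    orbitLiminf T f (T^[k] x) = orbitLiminf T f x := by
  induction k with
  | zero => rfl
  | succ k ih => rw [Function.iterate_succ_apply', orbitLiminf_apply, ih]

theorem orbitLiminf_symm_iterate (T : X ≃ᵐ X) (f : X → ℝ) (x : X) (k : ℕ) :
    orbitLiminf T.symm f (T^[k] x) = orbitLiminf T.symm f x := by
  induction k with
  | zero => rfl
  | succ k ih =>
    rw [Function.iterate_succ_apply', ← ih]
    exact orbitLiminf_symm_apply T.symm f _

/-- The points at which `f` is `ε`-close, but not equal, to its lower limit along the forward or
the backward orbit. -/
def markerSet (T : X ≃ᵐ X) (f : X → ℝ) (ε : ℝ) : Set X :=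
  {x | (|f x - orbitLiminf T f x| < ε ∨ |f x - orbitLiminf T.symm f x| < ε) ∧
    f x ≠ orbitLiminf T f x ∧ f x ≠ orbitLiminf T.symm f x}

theorem markerSet_symm (T : X ≃ᵐ X) (f : X → ℝ) (ε : ℝ) :
    markerSet T.symm f ε = markerSet T f ε := by
  ext x
  simp only [markerSet, MeasurableEquiv.symm_symm, Set.mem_ofPred_eq]
  tauto

theorem measurableSet_markerSet (T : X ≃ᵐ X) {f : X → ℝ} (hf : Measurable f) (ε : ℝ) :
    MeasurableSet (markerSet T f ε) := by
  have h1 := measurable_orbitLiminf T hf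
  have h2 := measurable_orbitLiminf T.symm hf
  have h3 : Measurable fun x => |f x - orbitLiminf T f x| := (hf.sub h1).abs
  have h4 : Measurable fun x => |f x - orbitLiminf T.symm f x| := (hf.sub h2).abs
  exact ((measurableSet_lt h3 measurable_const).union (measurableSet_lt h4 measurable_const)).inter
    ((measurableSet_eq_fun hf h1).compl.inter (measurableSet_eq_fun hf h2).compl)

theorem iterate_injective_of_aperiodic (T : X ≃ᵐ X) (hT : ∀ (x : X) (n : ℕ), 0 < n → T^[n] x ≠ x)
    (x : X) : Function.Injective fun k => T^[k] x := by
  have key : ∀ j k, j < k → T^[j] x ≠ T^[k] x := fun j k hjk h => by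
    refine hT x (k - j) (by omega) ?_
    rw [← symm_iterate_iterate_of_le T hjk.le, ← h, symm_iterate_iterate]
  intro j k h
  by_contra hne
  rcases Nat.lt_or_gt_of_ne hne with h' | h'
  · exact key j k h' h
  · exact key k j h' h.symm

theorem exists_iterate_mem_markerSet (T : X ≃ᵐ X)
    (hT : ∀ (x : X) (n : ℕ), 0 < n → T^[n] x ≠ x) {f : X → ℝ} (hf : Function.Injective f) {C : ℝ}
    (hC : ∀ x, |f x| ≤ C) {ε : ℝ} (hε : 0 < ε) (x : X) :
    ∃ k, 0 < k ∧ T^[k] x ∈ markerSet T f ε := by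
  have hinj : Function.Injective fun k => f (T^[k] x) :=
    hf.comp (iterate_injective_of_aperiodic T hT x)
  have hne : ∀ c, ∀ᶠ k in atTop, f (T^[k] x) ≠ c := fun c => by
    rw [← Nat.cofinite_eq_atTop]
    exact hinj.tendsto_cofinite.eventually (eventually_cofinite_ne c)
  have h := frequently_abs_sub_liminf_lt (fun k => hC (T^[k] x)) hε
  obtain ⟨k, ⟨⟨h1, h2⟩, h3⟩, h4⟩ := (((h.and_eventually (hne (orbitLiminf T f x))).and_eventually
    (hne (orbitLiminf T.symm f x))).and_eventually (eventually_gt_atTop 0)).exists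
  refine ⟨k, h4, ?_⟩
  rw [markerSet, Set.mem_ofPred_eq, orbitLiminf_iterate, orbitLiminf_symm_iterate]
  exact ⟨Or.inl h1, h2, h3⟩

theorem symm_aperiodic (T : X ≃ᵐ X) (hT : ∀ (x : X) (n : ℕ), 0 < n → T^[n] x ≠ x) (x : X) (n : ℕ)
    (hn : 0 < n) : T.symm^[n] x ≠ x := fun h =>
  hT x n hn (by conv_lhs => rw [← h, iterate_symm_iterate])

/-- An aperiodic Borel automorphism has a vanishing sequence of markers. -/
theorem exists_vanishing_markers [StandardBorelSpace X] (T : X ≃ᵐ X)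
    (hT : ∀ (x : X) (n : ℕ), 0 < n → T^[n] x ≠ x) :
    ∃ A : ℕ → Set X, A 0 = Set.univ ∧ (∀ n, A (n + 1) ⊆ A n) ∧ (∀ n, IsBirecurrent T (A n)) ∧
      (∀ x, ∃ n, x ∉ A n) ∧ ∀ n, MeasurableSet (A n) := by
  obtain ⟨g, hg⟩ := MeasureTheory.exists_measurableEmbedding_real X
  -- Boundedness makes the real lower limits genuine.
  let f : X → ℝ := fun x => Real.arctan (g x)
  have hfm : Measurable f := Real.continuous_arctan.measurable.comp hg.measurable
  have hfi : Function.Injective f := Real.arctan_injective.comp hg.injective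
  have hC : ∀ x, |f x| ≤ Real.pi / 2 := fun x =>
    abs_le.2 ⟨(Real.neg_pi_div_two_lt_arctan _).le, (Real.arctan_lt_pi_div_two _).le⟩
  let A : ℕ → Set X := fun n => Nat.casesOn n Set.univ fun n => markerSet T f (1 / (n + 1))
  refine ⟨A, rfl, ?_, ?_, fun x => ?_, ?_⟩
  · rintro (_ | n)
    · exact Set.subset_univ _
    · rintro x ⟨h1, h2⟩
      have h : (1 : ℝ) / ((n + 1 : ℕ) + 1) ≤ 1 / (n + 1) := by
        push_cast
        exact one_div_le_one_div_of_le (by positivity) (by linarith)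
      exact ⟨h1.imp (fun h' => h'.trans_le h) (fun h' => h'.trans_le h), h2⟩
  · rintro (_ | n)
    · exact ⟨fun x => ⟨1, one_pos, Set.mem_univ _⟩, fun x => ⟨0, Set.mem_univ _⟩⟩
    · refine ⟨exists_iterate_mem_markerSet T hT hfi hC (ε := 1 / (n + 1)) (by positivity),
        fun x => ?_⟩
      obtain ⟨k, -, hk⟩ := exists_iterate_mem_markerSet T.symm (symm_aperiodic T hT) hfi hC
        (ε := 1 / (n + 1)) (by positivity) x
      rw [markerSet_symm] at hk
      exact ⟨k, hk⟩
  · by_contra hx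
    have h : ∀ n, x ∈ A n := fun n => not_not.1 fun h => hx ⟨n, h⟩
    have h1 : x ∈ markerSet T f (1 / ((0 : ℕ) + 1)) := h 1
    -- Since `f x` equals neither lower limit, both distances are positive and some `1 / (n + 1)` is
    -- below them.
    obtain ⟨n, hn⟩ := exists_nat_one_div_lt (lt_min (abs_pos.2 (sub_ne_zero.2 h1.2.1))
      (abs_pos.2 (sub_ne_zero.2 h1.2.2)))
    have h2 : x ∈ markerSet T f (1 / (n + 1)) := h (n + 1)
    rcases h2.1 with h3 | h3
    · exact (h3.trans hn).not_ge (min_le_left _ _)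
    · exact (h3.trans hn).not_ge (min_le_right _ _)
  · rintro (_ | n)
    · exact MeasurableSet.univ
    · exact measurableSet_markerSet T hfm _

end Markers

/-! ### Borel sets as injective projections of closed sets -/

section ClosedWitness

/-- `S` is the bijective projection of a closed set: there is a measurable `w` such that a point
of the Baire space approximated by points `y ∈ S` whose values `w y` also converge is in `S`. -/
def HasClosedWitness (S : Set (ℕ → ℕ)) : Prop :=
  ∃ w : (ℕ → ℕ) → ℕ → ℕ, Measurable w ∧
    ∀ a b : ℕ → ℕ, (∀ m, ∃ y ∈ S, ∀ j < m, y j = a j ∧ w y j = b j) → a ∈ S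

theorem hasClosedWitness_coord (i : ℕ) (t : Set ℕ) : HasClosedWitness {y | y i ∈ t} := by
  refine ⟨fun _ _ => 0, measurable_const, fun a b h => ?_⟩
  obtain ⟨y, hy, hya⟩ := h (i + 1)
  have := (hya i (Nat.lt_succ_self i)).1
  change a i ∈ t
  rwa [← this]

/-- The countably many witnesses are interleaved into one by `Nat.pair`. -/
theorem HasClosedWitness.iInter {S : ℕ → Set (ℕ → ℕ)} (h : ∀ i, HasClosedWitness (S i)) :
    HasClosedWitness (⋂ i, S i) := by
  choose w hw hc using h
  refine ⟨fun y k => w k.unpair.1 y k.unpair.2,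
    measurable_pi_lambda _ fun k => (measurable_pi_apply _).comp (hw _), fun a b h => ?_⟩
  refine Set.mem_iInter.2 fun i => hc i a (fun j => b (Nat.pair i j)) fun m => ?_
  obtain ⟨y, hy, hyab⟩ := h (Nat.pair i m)
  refine ⟨y, Set.mem_iInter.1 hy i, fun j hj => ⟨(hyab j ?_).1, ?_⟩⟩
  · exact hj.trans_le (Nat.right_le_pair i m)
  · simpa using (hyab (Nat.pair i j) (Nat.pair_lt_pair_right i hj)).2

/-- The witness also records the index of the piece containing `y`; convergence of its coordinate 0
then fixes the piece. -/
theorem HasClosedWitness.iUnion_disjoint {S : ℕ → Set (ℕ → ℕ)} (hm : ∀ i, MeasurableSet (S i))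
    (hd : ∀ i j, i ≠ j → Disjoint (S i) (S j)) (h : ∀ i, HasClosedWitness (S i)) :
    HasClosedWitness (⋃ i, S i) := by
  classical
  choose w hw hc using h
  let idx : (ℕ → ℕ) → ℕ := fun y => sInf {i | y ∈ S i}
  have hidx : ∀ i, ∀ y ∈ S i, idx y = i := fun i y hy => by
    by_contra hne
    exact Set.disjoint_left.1 (hd _ _ hne) (Nat.sInf_mem (s := {i | y ∈ S i}) ⟨i, hy⟩) hy
  have hidx' : ∀ y ∈ ⋃ i, S i, y ∈ S (idx y) := fun y hy => by
    obtain ⟨i, hi⟩ := Set.mem_iUnion.1 hy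
    rwa [hidx i y hi]
  have hmidx : Measurable idx := by
    refine measurable_to_countable' fun k => ?_
    -- Off the union `sInf ∅ = 0`, hence the extra term over `k = 0`.
    have : idx ⁻¹' {k} = S k ∪ ({_y | k = 0} ∩ (⋃ i, S i)ᶜ) := by
      ext y
      simp only [Set.mem_preimage, Set.mem_singleton_iff, Set.mem_union, Set.mem_inter_iff,
        Set.mem_ofPred_eq, Set.mem_compl_iff]
      constructor
      · rintro rfl
        by_cases hy : y ∈ ⋃ i, S i
        · exact Or.inl (hidx' y hy)
        · refine Or.inr ⟨?_, hy⟩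
          have : {i | y ∈ S i} = ∅ :=
            Set.eq_empty_of_forall_notMem fun i hi => hy (Set.mem_iUnion.2 ⟨i, hi⟩)
          simp [idx, this]
      · rintro (hy | ⟨rfl, hy⟩)
        · exact hidx k y hy
        · have : {i | y ∈ S i} = ∅ :=
            Set.eq_empty_of_forall_notMem fun i hi => hy (Set.mem_iUnion.2 ⟨i, hi⟩)
          simp [idx, this]
    rw [this]
    exact (hm k).union ((MeasurableSet.const _).inter (MeasurableSet.iUnion hm).compl)
  refine ⟨fun y k => Nat.pair (idx y) (w (idx y) y k), measurable_pi_lambda _ fun k => ?_,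
    fun a b h => ?_⟩
  · have h1 : Measurable fun p : ℕ × (ℕ → ℕ) => Nat.pair p.1 (w p.1 p.2 k) :=
      measurable_from_prod_countable_right fun i =>
        (measurable_of_countable (Nat.pair i)).comp ((measurable_pi_apply k).comp (hw i))
    exact h1.comp (hmidx.prodMk measurable_id)
  · obtain ⟨i, hi⟩ : ∃ i, i = (b 0).unpair.1 := ⟨_, rfl⟩
    refine Set.mem_iUnion.2 ⟨i, hc i a (fun j => (b j).unpair.2) fun m => ?_⟩
    obtain ⟨y, hy, hyab⟩ := h (m + 1)
    have h0 : idx y = i := by rw [hi, ← (hyab 0 (Nat.succ_pos m)).2, Nat.unpair_pair]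
    refine ⟨y, h0 ▸ hidx' y hy, fun j hj => ?_⟩
    obtain ⟨h1, h2⟩ := hyab j (by omega)
    refine ⟨h1, ?_⟩
    rw [← h2, Nat.unpair_pair, h0]

theorem hasClosedWitness_of_measurableSet {S : Set (ℕ → ℕ)} (hS : MeasurableSet S) :
    HasClosedWitness S := by
  -- Complements are carried along because making a union disjoint uses them.
  let M : MeasurableSpace (ℕ → ℕ) :=
    { MeasurableSet' := fun S => MeasurableSet S ∧ HasClosedWitness S ∧ HasClosedWitness Sᶜ
      measurableSet_empty := by
        refine ⟨MeasurableSet.empty, ?_, ?_⟩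
        · simpa using hasClosedWitness_coord 0 ∅
        · simpa using hasClosedWitness_coord 0 Set.univ
      measurableSet_compl := fun S hS => ⟨hS.1.compl, hS.2.2, by rw [compl_compl]; exact hS.2.1⟩
      measurableSet_iUnion := fun S hS => by
        refine ⟨MeasurableSet.iUnion fun i => (hS i).1, ?_, ?_⟩
        · have key : ∀ n, HasClosedWitness (disjointed S n) := fun n => by
            have : disjointed S n = ⋂ k : ℕ, if k < n then (S k)ᶜ else S n := by
              ext y
              rw [disjointed_eq_inter_compl]
              simp only [Set.mem_inter_iff, Set.mem_iInter, Set.mem_compl_iff]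
              constructor
              · rintro ⟨h1, h2⟩ k
                split_ifs with hk
                · exact h2 k hk
                · exact h1
              · intro h
                refine ⟨by simpa using h n, fun k hk => ?_⟩
                have := h k
                rwa [if_pos hk] at this
            rw [this]
            refine HasClosedWitness.iInter fun k => ?_
            split_ifs
            · exact (hS k).2.2
            · exact (hS n).2.1
          rw [← iUnion_disjointed]
          exact HasClosedWitness.iUnion_disjoint
            (fun n => MeasurableSet.disjointed (fun i => (hS i).1) n)
            (fun i j hij => disjoint_disjointed S hij) key
        · rw [Set.compl_iUnion]
          exact HasClosedWitness.iInter fun i => (hS i).2.2 }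
  have hle : MeasurableSpace.pi ≤ M := by
    refine iSup_le fun i => ?_
    rintro _ ⟨t, -, rfl⟩
    exact ⟨measurable_pi_apply i (MeasurableSet.of_discrete (s := t)),
      hasClosedWitness_coord i t, hasClosedWitness_coord i tᶜ⟩
  exact (hle S hS).2.1

/-- For an injective measurable `f` and a countable partition `p` there is a measurable `w` such
that convergence of `f`, `p` and `w` along a sequence produces a limit point. -/
theorem exists_partition_witness {X : Type*} [MeasurableSpace X] [StandardBorelSpace X]
    {f : X → ℕ → ℕ} (hf : Measurable f) (hfi : Function.Injective f) {p : X → ℕ}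
    (hp : Measurable p) :
    ∃ w : X → ℕ → ℕ, Measurable w ∧ ∀ (a b : ℕ → ℕ) (c : ℕ),
      (∀ m, ∃ x, p x = c ∧ ∀ j < m, f x j = a j ∧ w x j = b j) → ∃ z, f z = a ∧ p z = c := by
  -- Coding the class into every coordinate lets one Borel set, the range of `q`, serve all classes
  -- at once.
  let q : X → ℕ → ℕ := fun x j => Nat.pair (f x j) (p x)
  have hq : Measurable q := measurable_pi_lambda _ fun j =>
    (measurable_of_countable fun t : ℕ × ℕ => Nat.pair t.1 t.2).comp
      (((measurable_pi_apply j).comp hf).prodMk hp)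
  have hqi : Function.Injective q := fun x x' h => hfi (funext fun j =>
    (Nat.pair_eq_pair.1 (congrFun h j)).1)
  obtain ⟨w, hw, hc⟩ :=
    hasClosedWitness_of_measurableSet (hq.measurableEmbedding hqi).measurableSet_range
  refine ⟨fun x => w (q x), hw.comp hq, fun a b c h => ?_⟩
  obtain ⟨z, hz⟩ := hc (fun j => Nat.pair (a j) c) b fun m => by
    obtain ⟨x, hx, hxm⟩ := h m
    refine ⟨q x, ⟨x, rfl⟩, fun j hj => ⟨?_, (hxm j hj).2⟩⟩
    simp only [q, hx, (hxm j hj).1]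
  exact ⟨z, funext fun j => (Nat.pair_eq_pair.1 (congrFun hz j)).1,
    (Nat.pair_eq_pair.1 (congrFun hz 0)).2⟩

end ClosedWitness

/-! ### Construction of the tower system -/

section Construction

/-- A natural number coding the first `k` values of `u`. -/
def prefixCode (k : ℕ) (u : ℕ → ℕ) : ℕ := Encodable.encode ((List.range k).map u)

theorem prefixCode_eq {k k' : ℕ} {u u' : ℕ → ℕ} (h : prefixCode k u = prefixCode k' u') :
    k = k' ∧ ∀ i < k, u i = u' i := by
  have h := Encodable.encode_injective h
  have hk : k = k' := by simpa using congrArg List.length h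
  subst hk
  exact ⟨rfl, fun i hi => List.map_inj_left.1 h i (List.mem_range.2 hi)⟩

variable {X : Type*} [MeasurableSpace X]

theorem measurable_prefixCode (k : ℕ) {h : ℕ → X → ℕ} (hh : ∀ i, Measurable (h i)) :
    Measurable fun x => prefixCode k fun i => h i x := by
  let : MeasurableSpace (List ℕ) := ⊤
  have key : Measurable fun x => (List.range k).map fun i => h i x := by
    induction k with
    | zero => exact measurable_const
    | succ k ih =>
      simp only [List.range_succ, List.map_append, List.map_singleton]
      exact (measurable_of_countable fun p : List ℕ × ℕ => p.1 ++ [p.2]).comp (ih.prodMk (hh k))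
  exact measurable_from_top.comp key

theorem Measurable.natPair {f g : X → ℕ} (hf : Measurable f) (hg : Measurable g) :
    Measurable fun x => Nat.pair (f x) (g x) :=
  (measurable_of_countable fun t : ℕ × ℕ => Nat.pair t.1 t.2).comp (hf.prodMk hg)

/-- Every countable partition `σ` gives rise to towers over `A` along which `σ` is constant. -/
theorem exists_tower_label {T : X ≃ᵐ X} {A : Set X} (hA : IsBirecurrent T A)
    (hm : MeasurableSet A) {σ : X → ℕ} (hσ : Measurable σ) :
    ∃ l : X → ℕ, Measurable l ∧ ∀ y y', l y = l y' → returnTime T A y = returnTime T A y' ∧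
      ∀ i < returnTime T A y, σ (T^[i] y) = σ (T^[i] y') := by
  refine ⟨fun y => prefixCode (returnTime T A y) fun i => σ (T^[i] y), ?_,
    fun y y' h => prefixCode_eq h⟩
  have h : Measurable fun p : ℕ × X => prefixCode p.1 fun i => σ (T^[i] p.2) :=
    measurable_from_prod_countable_right fun k =>
      measurable_prefixCode k fun i => hσ.comp (measurable_iterate T i)
  exact h.comp ((hA.measurable_returnTime hm).prodMk measurable_id)

theorem exists_partition_code {A : Set X} (hm : MeasurableSet A) {l : X → ℕ} (hl : Measurable l)
    {g : X → ℕ → ℕ} (hg : Measurable g) (n : ℕ) :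
    ∃ σ : X → ℕ, Measurable σ ∧ ∀ x x', σ x = σ x' →
      (x ∈ A → x' ∈ A) ∧ l x = l x' ∧ ∀ j ≤ n, g x j = g x' j := by
  classical
  have hi : Measurable fun x => if x ∈ A then 1 else 0 :=
    Measurable.ite hm measurable_const measurable_const
  refine ⟨_, hi.natPair (hl.natPair (measurable_prefixCode (n + 1) (h := fun j x => g x j)
    fun j => (measurable_pi_apply j).comp hg)), fun x x' h => ?_⟩
  obtain ⟨h1, h2⟩ := Nat.pair_eq_pair.1 h
  obtain ⟨h2, h3⟩ := Nat.pair_eq_pair.1 h2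
  refine ⟨fun hx => ?_, h2, fun j hj => (prefixCode_eq h3).2 j (Nat.lt_succ_of_le hj)⟩
  by_contra hx'
  simp [hx, hx'] at h1

/-- Refinement of a system of towers: the new towers over `A'` resolve `A`, the old labels `l` and
the first values of `g`, and their atoms are closed relative to `f` and the extension `g'` of
`g`. -/
theorem exists_refined_towers [StandardBorelSpace X] {T : X ≃ᵐ X} {A A' : Set X}
    (hA' : IsBirecurrent T A') (hm : MeasurableSet A) (hm' : MeasurableSet A')
    {f : X → ℕ → ℕ} (hf : Measurable f) (hfi : Function.Injective f) (n : ℕ)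
    {l : X → ℕ} (hl : Measurable l) {g : X → ℕ → ℕ} (hg : Measurable g) :
    ∃ (l' : X → ℕ) (g' : X → ℕ → ℕ), Measurable l' ∧ Measurable g' ∧
      (∀ y y', l' y = l' y' → returnTime T A' y = returnTime T A' y' ∧
        ∀ i < returnTime T A' y, (T^[i] y ∈ A → T^[i] y' ∈ A) ∧ l (T^[i] y) = l (T^[i] y') ∧
          ∀ j ≤ n, g (T^[i] y) j = g (T^[i] y') j) ∧
      (∀ x x' j, g' x j = g' x' j → g x j = g x' j) ∧
      ∀ (a b : ℕ → ℕ) (v k : ℕ), (∀ m, ∃ x, (l' (lastVisit T A' x) = v ∧ backTime T A' x = k) ∧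
          ∀ j < m, f x j = a j ∧ g' x j = b j) →
        ∃ z, f z = a ∧ l' (lastVisit T A' z) = v ∧ backTime T A' z = k := by
  obtain ⟨σ, hσ, hσ'⟩ := exists_partition_code hm hl hg n
  -- The witness `w` depends on the new towers, so they cannot resolve it; it enters `g'` and is
  -- left to later levels.
  obtain ⟨l', hl', hll'⟩ := exists_tower_label hA' hm' hσ
  obtain ⟨w, hw, hww⟩ := exists_partition_witness hf hfi
    ((hl'.comp (hA'.measurable_lastVisit hm')).natPair (hA'.measurable_backTime hm'))
  refine ⟨l', fun x j => Nat.pair (g x j) (w x j), hl', measurable_pi_lambda _ fun j =>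
    ((measurable_pi_apply j).comp hg).natPair ((measurable_pi_apply j).comp hw), ?_, ?_, ?_⟩
  · intro y y' h
    obtain ⟨h1, h2⟩ := hll' y y' h
    exact ⟨h1, fun i hi => hσ' _ _ (h2 i hi)⟩
  · exact fun x x' j h => (Nat.pair_eq_pair.1 h).1
  · intro a b v k h
    obtain ⟨z, hz, hzc⟩ := hww a (fun j => (b j).unpair.2) (Nat.pair v k) fun m => by
      obtain ⟨x, ⟨hx1, hx2⟩, hx3⟩ := h m
      refine ⟨x, by simp only [Function.comp_apply, hx1, hx2], fun j hj => ⟨(hx3 j hj).1, ?_⟩⟩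
      rw [← (hx3 j hj).2, Nat.unpair_pair]
    exact ⟨z, hz, Nat.pair_eq_pair.1 hzc⟩

theorem exists_towerSystem [StandardBorelSpace X] (T : X ≃ᵐ X)
    (hT : ∀ (x : X) (n : ℕ), 0 < n → T^[n] x ≠ x) : Nonempty (TowerSystem T) := by
  obtain ⟨A, hA0, hAs, hAr, hAe, hAm⟩ := exists_vanishing_markers T hT
  obtain ⟨f, hf, hfi⟩ : ∃ f : X → ℕ → ℕ, Measurable f ∧ Function.Injective f := by
    obtain ⟨f, hf, hfi⟩ := MeasurableSpace.measurable_injection_nat_bool_of_countablySeparated X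
    refine ⟨fun x j => (f x j).toNat, measurable_pi_lambda _ fun j =>
      (measurable_of_countable Bool.toNat).comp ((measurable_pi_apply j).comp hf),
      fun x x' h => hfi (funext fun j => ?_)⟩
    have hj : (f x j).toNat = (f x' j).toNat := congrFun h j
    revert hj
    cases f x j <;> cases f x' j <;> simp
  let State := {s : (X → ℕ) × (X → ℕ → ℕ) // Measurable s.1 ∧ Measurable s.2}
  have hstep : ∀ (n : ℕ) (s : State), ∃ s' : State,
      (∀ y y', s'.1.1 y = s'.1.1 y' → returnTime T (A (n + 1)) y = returnTime T (A (n + 1)) y' ∧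
        ∀ i < returnTime T (A (n + 1)) y, (T^[i] y ∈ A n → T^[i] y' ∈ A n) ∧
          s.1.1 (T^[i] y) = s.1.1 (T^[i] y') ∧
          ∀ j ≤ n, s.1.2 (T^[i] y) j = s.1.2 (T^[i] y') j) ∧
      (∀ x x' j, s'.1.2 x j = s'.1.2 x' j → s.1.2 x j = s.1.2 x' j) ∧
      ∀ (a b : ℕ → ℕ) (v k : ℕ), (∀ m, ∃ x, (s'.1.1 (lastVisit T (A (n + 1)) x) = v ∧
          backTime T (A (n + 1)) x = k) ∧ ∀ j < m, f x j = a j ∧ s'.1.2 x j = b j) →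
        ∃ z, f z = a ∧ s'.1.1 (lastVisit T (A (n + 1)) z) = v ∧
          backTime T (A (n + 1)) z = k := by
    rintro n ⟨⟨l, g⟩, hl, hg⟩
    obtain ⟨l', g', hl', hg', h⟩ := exists_refined_towers (hAr (n + 1)) (hAm n) (hAm (n + 1))
      hf hfi n hl hg
    exact ⟨⟨⟨l', g'⟩, hl', hg'⟩, h⟩
  choose step hdet hext hclosed using hstep
  let s : ℕ → State := fun n =>
    Nat.rec ⟨(fun _ => 0, f), measurable_const, hf⟩ step n
  let label : ℕ → X → ℕ := fun n => (s n).1.1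
  let g : ℕ → X → ℕ → ℕ := fun n => (s n).1.2
  have hg0 : g 0 = f := rfl
  have hgm : ∀ n N, n ≤ N → ∀ x x' j, g N x j = g N x' j → g n x j = g n x' j := by
    intro n N hN
    induction N, hN using Nat.le_induction with
    | base => exact fun x x' j h => h
    | succ N _ ih => exact fun x x' j h => ih x x' j (hext N (s N) x x' j h)
  let Same : ℕ → X → X → Prop := fun n x x' =>
    label n (lastVisit T (A n) x) = label n (lastVisit T (A n) x') ∧
      backTime T (A n) x = backTime T (A n) x'
  -- Points at equal heights over equally labelled base points agree in all data resolved along the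
  -- tower.
  have hsame : ∀ n x x', Same (n + 1) x x' → ∀ j ≤ n, g n x j = g n x' j := by
    rintro n x x' ⟨h1, h2⟩ j hj
    have h3 := ((hdet n (s n) _ _ h1).2 _ ((hAr (n + 1)).backTime_lt_returnTime x)).2.2 j hj
    rw [iterate_lastVisit, h2, iterate_lastVisit] at h3
    exact h3
  refine ⟨{ A := A, label := label, A_zero := hA0, A_succ_subset := hAs, birecurrent := hAr
            exists_notMem := hAe, measurableSet_A := hAm
            measurable_label := fun n => (s n).2.1
            label_zero := fun _ => rfl
            returnTime_eq := fun _ _ h => (hdet _ _ _ _ h).1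
            mem_of_mem := fun _ _ h hi => ((hdet _ _ _ _ h).2 _ hi).1
            label_eq := fun _ _ h hi => ((hdet _ _ _ _ h).2 _ hi).2.1
            separates := ?_
            complete := ?_ }⟩
  · exact fun x x' h => hfi (funext fun j =>
      hgm 0 j (Nat.zero_le j) x x' j (hsame j x x' (h (j + 1)) j le_rfl))
  · intro v K h
    choose x hx using h
    -- The limit of `g n (x m) j` in `m`: level `max n j + 1` resolves coordinate `j` of `g (max n
    -- j)`, hence of `g n`.
    let b : ℕ → ℕ → ℕ := fun n j => g n (x (max n j + 1)) j
    have hb : ∀ n j m, max n j + 1 ≤ m → g n (x m) j = b n j := by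
      intro n j m hm
      refine hgm n (max n j) (le_max_left n j) _ _ j
        (hsame _ _ _ ?_ j (le_max_right n j))
      obtain ⟨h1, h2⟩ := hx m _ hm
      obtain ⟨h3, h4⟩ := hx _ _ (le_refl (max n j + 1))
      exact ⟨h1.trans h3.symm, h2.trans h4.symm⟩
    -- Each atom separately contains a point with `f z = b 0`; injectivity of `f` makes these points
    -- one.
    have hz : ∀ n, ∃ z, f z = b 0 ∧ label (n + 1) (lastVisit T (A (n + 1)) z) = v (n + 1) ∧
        backTime T (A (n + 1)) z = K (n + 1) := fun n =>
      hclosed n (s n) (b 0) (b (n + 1)) _ _ fun m =>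
        ⟨x (max (n + 1) m + 1), hx _ (n + 1) (by omega), fun j hj =>
          ⟨hb 0 j _ (by omega), hb (n + 1) j _ (by omega)⟩⟩
    choose z hzf hzv using hz
    refine ⟨z 0, fun n => ?_⟩
    cases n with
    | zero =>
      obtain ⟨h1, h2⟩ := hx 0 0 le_rfl
      have hA : ∀ y, y ∈ A 0 := fun y => hA0 ▸ Set.mem_univ y
      exact ⟨h1, by rw [← h2, backTime_of_mem (hA _), backTime_of_mem (hA _)]⟩
    | succ n =>
      rw [hfi ((hzf 0).trans (hzf n).symm)]
      exact hzv n

end Construction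

theorem theorem4p2 {X : Type*} [MeasurableSpace X] [StandardBorelSpace X] [Nonempty X]
    (T : X ≃ᵐ X) (hT : ∀ (x : X) (n : ℕ), 0 < n → T^[n] x ≠ x) :
    ∃ (B : OrderedBorelBratteliDiagram) (φ : B.Path ≃ᵐ B.Path),
      (∀ y, φ y = B.vershik y) ∧
        ∃ F : X ≃ᵐ B.Path, ∀ x, F (T x) = φ (F x) := by
  obtain ⟨S⟩ := exists_towerSystem T hT
  exact S.exists_vershik_isomorphism
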